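/- Let $\varepsilon>0$, $d\ge 0$, and let $\mu,\nu$ be Borel probability measures on $\mathbb{R}^d$ such that $\int\|x\|^2\,d\mu(x)<\infty$ and $\nu$ is subgaussian, i.e. there is $\sigma>0$ with $\int e^{\langle y,v\rangle^2/\sigma^2}\,d\nu(y)\le 2$ for every unit vector $v\in\mathbb{R}^d$. Let $(f_0,g_0)\in L^1(\mu)\times L^1(\nu)$ be any pair of (real-valued) entropic potentials, that is, any maximizer over $L^1(\mu)\times L^1(\nu)$ of $$(f,g)\mapsto\int f\,d\mu+\int g\,d\nu-\varepsilon\iint\Big(e^{-\frac1\varepsilon\left(\frac12\|x-y\|^2-f(x)-g(y)\right)}-1\Big)d\mu(x)\,d\nu(y).$$ Then there is exactly one pair of extended potentials $f=f^\varepsilon_{\mu\to\nu}$, $g=g^\varepsilon_{\mu\to\nu}$, i.e. of functions $f,g:\mathbb{R}^d\to[-\infty,\infty]$ with $f=f_0$ $\mu$-a.e., $g=g_0$ $\nu$-a.e., and, for all $x,y\in\mathbb{R}^d$, $$f(x)=-\varepsilon\log\int e^{\frac1\varepsilon\left(-\frac12\|x-y\|^2+g(y)\right)}d\nu(y),\qquad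 g(y)=-\varepsilon\log\int e^{\frac1\varepsilon\left(-\frac12\|x-y\|^2+f(x)\right)}d\mu(x).$$ Moreover $f$ is finite and $C^\infty$ on all of $\mathbb{R}^d$, and for every $x\in\mathbb{R}^d$ $$\nabla f(x)=x-T^\varepsilon_{\mu\to\nu}(x),\qquad T^\varepsilon_{\mu\to\nu}(x):=\frac{\int y\,e^{\frac1\varepsilon\left(-\frac12\|x-y\|^2+g(y)\right)}d\nu(y)}{\int e^{\frac1\varepsilon\left(-\frac12\|x-y\|^2+g(y)\right)}d\nu(y)},$$ where both integrals converge absolutely and the denominator is positive. -/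

import Mathlib

open MeasureTheory

namespace EntropicOT

/-- `ν` is subgaussian: for some `σ > 0`, `𝔼_{X ∼ ν} exp (⟨X, v⟩² / σ²) ≤ 2` for every unit
vector `v`. (The expectation is taken in `[0, ∞]`, so it is a genuine finiteness condition.) -/
def IsSubgaussian {d : ℕ} (ν : Measure (EuclideanSpace ℝ (Fin d))) : Prop :=
  ∃ σ : ℝ, 0 < σ ∧ ∀ v : EuclideanSpace ℝ (Fin d), ‖v‖ = 1 →
    ∫⁻ x, ENNReal.ofReal (Real.exp ((inner ℝ x v) ^ 2 / σ ^ 2)) ∂ν ≤ 2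

/-- `μ` has a finite second moment. -/
def HasFiniteSecondMoment {d : ℕ} (μ : Measure (EuclideanSpace ℝ (Fin d))) : Prop :=
  Integrable (fun x => ‖x‖ ^ 2) μ

/-- The objective of the dual of entropic optimal transport with cost `½‖x - y‖²`, for
`f ∈ L¹(μ)`, `g ∈ L¹(ν)` and probability measures `μ`, `ν`:
`∫ f dμ + ∫ g dν - ε ∫∫ (exp (-(½‖x - y‖² - f x - g y) / ε) - 1) dμ dν`.
The exponential may fail to be integrable, in which case the value is `-∞`; since `μ ⊗ ν` has
mass one, the integral of the constant `1` is `1`. -/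
noncomputable def dualObjective {d : ℕ} (ε : ℝ) (μ ν : Measure (EuclideanSpace ℝ (Fin d)))
    (f g : EuclideanSpace ℝ (Fin d) → ℝ) : EReal :=
  ((∫ x, f x ∂μ + ∫ y, g y ∂ν : ℝ) : EReal) -
    (ε : EReal) * (((∫⁻ p, ENNReal.ofReal
      (Real.exp (-(1 / ε) * (1 / 2 * ‖p.1 - p.2‖ ^ 2 - f p.1 - g p.2))) ∂(μ.prod ν) :
        ENNReal) : EReal) - 1)

/-- `(f, g)` is a pair of entropic potentials: a maximizer of the dual objective over
`L¹(μ) × L¹(ν)`. -/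
def IsEntropicPotentials {d : ℕ} (ε : ℝ) (μ ν : Measure (EuclideanSpace ℝ (Fin d)))
    (f g : EuclideanSpace ℝ (Fin d) → ℝ) : Prop :=
  Integrable f μ ∧ Integrable g ν ∧
    ∀ f' g' : EuclideanSpace ℝ (Fin d) → ℝ, Integrable f' μ → Integrable g' ν →
      dualObjective ε μ ν f' g' ≤ dualObjective ε μ ν f g

/-- The weight `exp ((-½‖x - y‖² + g y) / ε) ∈ [0, ∞]`, for an extended-real-valued `g`. -/
noncomputable def gibbsWeight {d : ℕ} (ε : ℝ) (g : EuclideanSpace ℝ (Fin d) → EReal)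
    (x y : EuclideanSpace ℝ (Fin d)) : ENNReal :=
  EReal.exp (((1 / ε : ℝ) : EReal) * (((-(1 / 2 * ‖x - y‖ ^ 2) : ℝ) : EReal) + g y))

/-- The function `x ↦ -ε log ∫ exp ((-½‖x - y‖² + g y) / ε) dν(y)`, with values in `[-∞, ∞]`. -/
noncomputable def softTransform {d : ℕ} (ε : ℝ) (ν : Measure (EuclideanSpace ℝ (Fin d)))
    (g : EuclideanSpace ℝ (Fin d) → EReal) (x : EuclideanSpace ℝ (Fin d)) : EReal :=
  -((ε : EReal) * ENNReal.log (∫⁻ y, gibbsWeight ε g x y ∂ν))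

/-- `(f, g)` is the pair of extended entropic potentials of `(f₀, g₀)`: `f` and `g` agree a.e.
with `f₀` and `g₀`, and the two duality equations hold at every point of `ℝ^d`. -/
structure IsExtension {d : ℕ} (ε : ℝ) (μ ν : Measure (EuclideanSpace ℝ (Fin d)))
    (f₀ g₀ : EuclideanSpace ℝ (Fin d) → ℝ) (f g : EuclideanSpace ℝ (Fin d) → EReal) : Prop where
  f_ae : ∀ᵐ x ∂μ, f x = (f₀ x : EReal)
  g_ae : ∀ᵐ y ∂ν, g y = (g₀ y : EReal)
  f_eq : ∀ x, f x = softTransform ε ν g x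
  g_eq : ∀ y, g y = softTransform ε μ f y

/-- The entropic map `T(x) = ∫ y w(x, y) dν(y) / ∫ w(x, y) dν(y)`, where
`w(x, y) = exp ((-½‖x - y‖² + g y) / ε)`. -/
noncomputable def entropicMap {d : ℕ} (ε : ℝ) (ν : Measure (EuclideanSpace ℝ (Fin d)))
    (g : EuclideanSpace ℝ (Fin d) → EReal) (x : EuclideanSpace ℝ (Fin d)) :
    EuclideanSpace ℝ (Fin d) :=
  (∫ y, (gibbsWeight ε g x y).toReal ∂ν)⁻¹ • ∫ y, (gibbsWeight ε g x y).toReal • y ∂ν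

end EntropicOT

-- Varying a maximizer `f₀` along `s • 1_A` gives the first-order condition: the Gibbs density of
-- `(f₀, g₀)` has integral `1` in `y` for `μ`-a.e. `x`, and symmetrically in `x`
-- (`setLIntegral_gibbsDensity`, `lintegral_gibbsDensity_eq_one`). After `-ε log` these are the
-- duality equations almost everywhere. A soft transform sees only the a.e. class of its argument,
-- so the transforms of `g₀` and `f₀` form an extension, and every extension must equal them.
--
-- For regularity, expand the square: `f x = ½‖x‖² - ε log L(x / ε)`, where `L` is the Laplace
-- transform of `exp ((g₀ - ½‖y‖²) / ε) ν`. Jensen's inequality in the second duality equation gives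
-- `g₀ y ≤ ½‖y‖² + M‖y‖ + C` (`snd_le`). The quadratic terms cancel exactly, so this density grows
-- at most like `exp (M‖y‖ / ε)`; a subgaussian `ν` integrates this against every exponential of
-- `‖y‖`, whatever `σ` and `ε` are. Hence `L` is positive and smooth by differentiation under the
-- integral, and the gradient formula is the logarithmic derivative of `L`.

universe u

namespace EntropicOT

/-! ### First-order optimality conditions for the dual problem. -/

section
variable {d : ℕ} {ε : ℝ} {μ ν : Measure (EuclideanSpace ℝ (Fin d))}
  {f g : EuclideanSpace ℝ (Fin d) → ℝ}

/-- The density of the Gibbs coupling of `f` and `g` with respect to the product measure. -/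
noncomputable def gibbsDensity {d : ℕ} (ε : ℝ) (f g : EuclideanSpace ℝ (Fin d) → ℝ)
    (p : EuclideanSpace ℝ (Fin d) × EuclideanSpace ℝ (Fin d)) : ENNReal :=
  ENNReal.ofReal (Real.exp (-(1 / ε) * (1 / 2 * ‖p.1 - p.2‖ ^ 2 - f p.1 - g p.2)))

lemma gibbsDensity_swap (p : EuclideanSpace ℝ (Fin d) × EuclideanSpace ℝ (Fin d)) :
    gibbsDensity ε g f p.swap = gibbsDensity ε f g p := by
  simp only [gibbsDensity, Prod.fst_swap, Prod.snd_swap, norm_sub_rev p.2 p.1]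
  congr 3
  ring

lemma aemeasurable_gibbsDensity [SFinite μ] [SFinite ν] (hf : AEMeasurable f μ)
    (hg : AEMeasurable g ν) : AEMeasurable (gibbsDensity ε f g) (μ.prod ν) := by
  have h1 : AEMeasurable (fun p : EuclideanSpace ℝ (Fin d) × EuclideanSpace ℝ (Fin d) => f p.1)
      (μ.prod ν) := hf.comp_quasiMeasurePreserving Measure.quasiMeasurePreserving_fst
  have h2 : AEMeasurable (fun p : EuclideanSpace ℝ (Fin d) × EuclideanSpace ℝ (Fin d) => g p.2)
      (μ.prod ν) := hg.comp_quasiMeasurePreserving Measure.quasiMeasurePreserving_snd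
  unfold gibbsDensity
  have h3 : AEMeasurable (fun p : EuclideanSpace ℝ (Fin d) × EuclideanSpace ℝ (Fin d) =>
    1 / 2 * ‖p.1 - p.2‖ ^ 2) (μ.prod ν) := by fun_prop
  exact (Real.measurable_exp.comp_aemeasurable
    (((h3.sub h1).sub h2).const_mul _)).ennreal_ofReal

lemma dualObjective_swap [SFinite μ] [SFinite ν] (hf : AEMeasurable f μ) (hg : AEMeasurable g ν) :
    dualObjective ε ν μ g f = dualObjective ε μ ν f g := by
  have h : ∫⁻ p, gibbsDensity ε g f p ∂(ν.prod μ) = ∫⁻ p, gibbsDensity ε f g p ∂(μ.prod ν) := by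
    rw [← Measure.prod_swap, lintegral_map' _ measurable_swap.aemeasurable]
    · exact lintegral_congr gibbsDensity_swap
    · rw [Measure.prod_swap]
      exact aemeasurable_gibbsDensity hg hf
  unfold gibbsDensity at h
  rw [dualObjective, dualObjective, h, add_comm]

/-- Carries every statement about the first potential over to the second. -/
lemma IsEntropicPotentials.symm [SFinite μ] [SFinite ν] (h : IsEntropicPotentials ε μ ν f g) :
    IsEntropicPotentials ε ν μ g f := by
  refine ⟨h.2.1, h.1, fun g' f' hg' hf' => ?_⟩
  rw [dualObjective_swap hf'.aemeasurable hg'.aemeasurable,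
    dualObjective_swap h.1.aemeasurable h.2.1.aemeasurable]
  exact h.2.2 f' g' hf' hg'

lemma dualObjective_eq_coe (h : ∫⁻ p, gibbsDensity ε f g p ∂(μ.prod ν) ≠ ⊤) :
    dualObjective ε μ ν f g = ((∫ x, f x ∂μ + ∫ y, g y ∂ν -
      ε * ((∫⁻ p, gibbsDensity ε f g p ∂(μ.prod ν)).toReal - 1) : ℝ) : EReal) := by
  have key : ∀ (a : ℝ) (Z : ENNReal), Z ≠ ⊤ →
      (a : EReal) - (ε : EReal) * ((Z : EReal) - 1) = ((a - ε * (Z.toReal - 1) : ℝ) : EReal) := by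
    intro a Z hZ
    lift Z to NNReal using hZ
    simp only [ENNReal.coe_toReal, EReal.coe_sub, EReal.coe_mul, EReal.coe_one]
    rfl
  exact key _ _ h

lemma dualObjective_eq_bot (hε : 0 < ε) (h : ∫⁻ p, gibbsDensity ε f g p ∂(μ.prod ν) = ⊤) :
    dualObjective ε μ ν f g = ⊥ := by
  unfold gibbsDensity at h
  rw [dualObjective, h, EReal.coe_ennreal_top, ← EReal.coe_one, EReal.top_sub_coe,
    EReal.coe_mul_top_of_pos hε, EReal.sub_top]

/-- The competitor `(0, 0)` has a finite objective, since its density is at most `1`; an infinite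
mass would give `⊥`. -/
lemma IsEntropicPotentials.lintegral_gibbsDensity_ne_top [IsFiniteMeasure μ] [IsFiniteMeasure ν]
    (hε : 0 < ε) (h : IsEntropicPotentials ε μ ν f g) :
    ∫⁻ p, gibbsDensity ε f g p ∂(μ.prod ν) ≠ ⊤ := by
  intro htop
  have h0 := h.2.2 (fun _ => 0) (fun _ => 0) (integrable_zero _ _ _) (integrable_zero _ _ _)
  rw [dualObjective_eq_bot hε htop, le_bot_iff, dualObjective_eq_coe] at h0
  · exact EReal.coe_ne_bot _ h0
  · refine ((lintegral_mono (g := fun _ => 1) fun p => ?_).trans_lt ?_).ne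
    · rw [gibbsDensity, ENNReal.ofReal_le_one, Real.exp_le_one_iff]
      simp only [sub_zero, neg_mul, Left.neg_nonpos_iff]
      positivity
    · simp [measure_lt_top]

lemma IsEntropicPotentials.setLIntegral_gibbsDensity [IsProbabilityMeasure μ]
    [IsProbabilityMeasure ν] (hε : 0 < ε) (h : IsEntropicPotentials ε μ ν f g)
    {A : Set (EuclideanSpace ℝ (Fin d))} (hA : MeasurableSet A) :
    ∫⁻ p in Prod.fst ⁻¹' A, gibbsDensity ε f g p ∂(μ.prod ν) = μ A := by
  have hZ := h.lintegral_gibbsDensity_ne_top hε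
  have hB : MeasurableSet (Prod.fst ⁻¹' A :
    Set (EuclideanSpace ℝ (Fin d) × EuclideanSpace ℝ (Fin d))) := measurable_fst hA
  set B : Set (EuclideanSpace ℝ (Fin d) × EuclideanSpace ℝ (Fin d)) := Prod.fst ⁻¹' A
  have hsplit := lintegral_add_compl (μ := μ.prod ν) (gibbsDensity ε f g) hB
  have hB1 : ∫⁻ p in B, gibbsDensity ε f g p ∂(μ.prod ν) ≠ ⊤ :=
    ((setLIntegral_le_lintegral _ _).trans_lt hZ.lt_top).ne
  have hB2 : ∫⁻ p in Bᶜ, gibbsDensity ε f g p ∂(μ.prod ν) ≠ ⊤ :=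
    ((setLIntegral_le_lintegral _ _).trans_lt hZ.lt_top).ne
  set b := ∫⁻ p in B, gibbsDensity ε f g p ∂(μ.prod ν)
  set b' := ∫⁻ p in Bᶜ, gibbsDensity ε f g p ∂(μ.prod ν)
  -- Optimality against `f + s • 1_A`: the density is multiplied by `exp (s / ε)` over `A` and
  -- unchanged elsewhere. Equality holds at `s = 0`, so the difference of the two sides has a
  -- minimum there.
  have hvar : ∀ s : ℝ, s * μ.real A ≤ ε * ((Real.exp (s / ε) - 1) * b.toReal) := by
    intro s
    have hint : Integrable (A.indicator fun _ => s) μ := (integrable_const s).indicator hA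
    have hmass : ∫⁻ p, gibbsDensity ε (fun x => f x + A.indicator (fun _ => s) x) g p ∂(μ.prod ν) =
        ENNReal.ofReal (Real.exp (s / ε)) * b + b' := by
      rw [← lintegral_add_compl _ hB, ← lintegral_const_mul' _ _ ENNReal.ofReal_ne_top]
      congr 1
      · refine setLIntegral_congr_fun hB fun p hp => ?_
        have hp' : p.1 ∈ A := hp
        simp only [gibbsDensity, Set.indicator_of_mem hp']
        rw [← ENNReal.ofReal_mul (Real.exp_nonneg _), ← Real.exp_add]
        congr 2
        field_simp
        ring
      · refine setLIntegral_congr_fun hB.compl fun p hp => ?_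
        have hp' : p.1 ∉ A := hp
        simp only [gibbsDensity, Set.indicator_of_notMem hp', add_zero]
    have hopt := h.2.2 _ g (h.1.add hint) h.2.1
    have hmass_ne : ENNReal.ofReal (Real.exp (s / ε)) * b + b' ≠ ⊤ :=
      ENNReal.add_ne_top.2 ⟨ENNReal.mul_ne_top ENNReal.ofReal_ne_top hB1, hB2⟩
    rw [dualObjective_eq_coe hZ, show (f + A.indicator fun _ => s) =
      (fun x => f x + A.indicator (fun _ => s) x) from rfl,
      dualObjective_eq_coe (hmass ▸ hmass_ne), EReal.coe_le_coe_iff, hmass, ← hsplit,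
      ENNReal.toReal_add (ENNReal.mul_ne_top ENNReal.ofReal_ne_top hB1) hB2,
      ENNReal.toReal_add hB1 hB2, ENNReal.toReal_mul, ENNReal.toReal_ofReal (Real.exp_nonneg _),
      integral_add h.1 hint, integral_indicator_const s hA, smul_eq_mul] at hopt
    linarith
  have hder : HasDerivAt (fun s : ℝ => ε * ((Real.exp (s / ε) - 1) * b.toReal) - s * μ.real A)
      (b.toReal - μ.real A) 0 := by
    have h1 : HasDerivAt (fun s : ℝ => s / ε) (1 / ε) 0 := (hasDerivAt_id 0).div_const ε
    have h2 := (((h1.exp.sub_const 1).mul_const b.toReal).const_mul ε).sub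
      ((hasDerivAt_id (0 : ℝ)).mul_const (μ.real A))
    refine h2.congr_deriv ?_
    rw [zero_div, Real.exp_zero]
    field_simp
  have hmin : IsLocalMin (fun s : ℝ => ε * ((Real.exp (s / ε) - 1) * b.toReal) - s * μ.real A)
      0 := Filter.Eventually.of_forall fun s => by
    change ε * ((Real.exp (0 / ε) - 1) * b.toReal) - 0 * μ.real A ≤ _
    simpa using hvar s
  have h0 := hmin.hasDerivAt_eq_zero hder
  rw [← ENNReal.toReal_eq_toReal_iff' hB1 (measure_ne_top _ _)]
  exact sub_eq_zero.1 h0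

lemma IsEntropicPotentials.lintegral_gibbsDensity_eq_one [IsProbabilityMeasure μ]
    [IsProbabilityMeasure ν] (hε : 0 < ε) (h : IsEntropicPotentials ε μ ν f g) :
    ∀ᵐ x ∂μ, ∫⁻ y, gibbsDensity ε f g (x, y) ∂ν = 1 := by
  have hm := aemeasurable_gibbsDensity (ε := ε) h.1.aemeasurable h.2.1.aemeasurable
  refine ae_eq_of_forall_setLIntegral_eq_of_sigmaFinite₀ hm.lintegral_prod_right'
    aemeasurable_const fun A hA _ => ?_
  have h1 := h.setLIntegral_gibbsDensity hε hA
  rw [← Set.prod_univ, ← Measure.prod_restrict, Measure.restrict_univ, lintegral_prod] at h1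
  · simpa using h1
  · exact hm.mono_measure (Measure.prod_mono Measure.restrict_le_self le_rfl)

end

/-! ### Smoothness of Laplace transforms under exponential moment bounds. -/

section Laplace

variable {E : Type*} [NormedAddCommGroup E] [InnerProductSpace ℝ E] {F : Type*}
  [NormedAddCommGroup F] [NormedSpace ℝ F]

lemma norm_exp_inner_smul_le (x y : E) (v : F) :
    ‖Real.exp (inner ℝ x y) • v‖ ≤ Real.exp (‖x‖ * ‖y‖) * ‖v‖ := by
  rw [norm_smul, Real.norm_eq_abs, Real.abs_exp]
  gcongr
  exact real_inner_le_norm x y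

variable [MeasurableSpace E] [BorelSpace E]

lemma integrable_exp_inner_smul {ν : Measure E} {h : E → F} (hm : AEStronglyMeasurable h ν)
    (hi : ∀ a : ℝ, Integrable (fun y => Real.exp (a * ‖y‖) * ‖h y‖) ν) (x : E) :
    Integrable (fun y => Real.exp (inner ℝ x y) • h y) ν := by
  refine (hi ‖x‖).mono' ?_ (Filter.Eventually.of_forall fun y => norm_exp_inner_smul_le x y _)
  have : Continuous fun y : E => Real.exp (inner ℝ x y) := by fun_prop
  exact this.aestronglyMeasurable.smul hm

variable [SecondCountableTopology E]

lemma aestronglyMeasurable_innerSL_smulRight {ν : Measure E} {h : E → F}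
    (hm : AEStronglyMeasurable h ν) :
    AEStronglyMeasurable (fun y => (innerSL ℝ y).smulRight (h y)) ν := by
  have h1 : Continuous fun y : E => innerSL ℝ y := (innerSL ℝ).continuous
  exact (ContinuousLinearMap.smulRightL ℝ E F).aestronglyMeasurable_comp₂
    h1.aestronglyMeasurable hm

/-- Differentiating in `x` replaces `h y` by `⟨y, ·⟩ h y`. Because `‖y‖ ≤ exp ‖y‖`, the extra factor
only shifts `a` to `a + 1`, so the moment hypothesis survives and differentiation can be iterated.
-/
lemma integrable_exp_mul_norm_innerSL_smulRight {ν : Measure E} {h : E → F}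
    (hm : AEStronglyMeasurable h ν)
    (hi : ∀ a : ℝ, Integrable (fun y => Real.exp (a * ‖y‖) * ‖h y‖) ν) (a : ℝ) :
    Integrable (fun y => Real.exp (a * ‖y‖) * ‖(innerSL ℝ y).smulRight (h y)‖) ν := by
  refine (hi (a + 1)).mono' ?_ (Filter.Eventually.of_forall fun y => ?_)
  · have : Continuous fun y : E => Real.exp (a * ‖y‖) := by fun_prop
    exact this.aestronglyMeasurable.mul (aestronglyMeasurable_innerSL_smulRight hm).norm
  · rw [Real.norm_of_nonneg (by positivity), ContinuousLinearMap.norm_smulRight_apply,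
      innerSL_apply_norm, add_mul, Real.exp_add, one_mul, mul_assoc]
    gcongr
    linarith [Real.add_one_le_exp ‖y‖]

lemma hasFDerivAt_integral_exp_inner {ν : Measure E} {h : E → F} (hm : AEStronglyMeasurable h ν)
    (hi : ∀ a : ℝ, Integrable (fun y => Real.exp (a * ‖y‖) * ‖h y‖) ν) (x : E) :
    HasFDerivAt (fun x => ∫ y, Real.exp (inner ℝ x y) • h y ∂ν)
      (∫ y, Real.exp (inner ℝ x y) • (innerSL ℝ y).smulRight (h y) ∂ν) x := by
  have hm' := aestronglyMeasurable_innerSL_smulRight hm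
  have hi' := integrable_exp_mul_norm_innerSL_smulRight hm hi
  refine hasFDerivAt_integral_of_dominated_of_fderiv_le
    (F' := fun x y : E =>
      (Real.exp (inner ℝ x y) • (innerSL ℝ y).smulRight (h y) : E →L[ℝ] F))
    (Metric.ball_mem_nhds x one_pos)
    (Filter.Eventually.of_forall fun z => (integrable_exp_inner_smul hm hi z).1)
    (integrable_exp_inner_smul hm hi x) (integrable_exp_inner_smul hm' hi' x).1
    (Filter.Eventually.of_forall fun y z hz => ?_) (hi' (‖x‖ + 1))
    (Filter.Eventually.of_forall fun y z _ => ?_)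
  · refine (norm_exp_inner_smul_le z y ((innerSL ℝ y).smulRight (h y))).trans ?_
    have : ‖z‖ ≤ ‖x‖ + 1 := by
      have := norm_le_norm_add_norm_sub' z x
      rw [mem_ball_iff_norm] at hz
      linarith
    gcongr
  · have h1 : HasFDerivAt (fun z : E => inner ℝ z y) (innerSL ℝ y) z := by
      simp_rw [real_inner_comm y]
      exact (innerSL ℝ y).hasFDerivAt
    convert h1.exp.smul_const (h y) using 1
    ext w
    simp [mul_smul]

lemma integrable_exp_mul_inner_smul_self {ν : Measure E} {h : E → ℝ}
    (hm : AEStronglyMeasurable h ν)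
    (hi : ∀ a : ℝ, Integrable (fun y => Real.exp (a * ‖y‖) * ‖h y‖) ν) (x : E) :
    Integrable (fun y => (Real.exp (inner ℝ x y) * h y) • y) ν := by
  have hm' : AEStronglyMeasurable (fun y : E => h y • y) ν :=
    hm.smul continuous_id.aestronglyMeasurable
  simp_rw [mul_smul]
  refine integrable_exp_inner_smul hm' (fun a => ?_) x
  refine (integrable_exp_mul_norm_innerSL_smulRight hm hi a).congr
    (Filter.Eventually.of_forall fun y => ?_)
  simp only [ContinuousLinearMap.norm_smulRight_apply, innerSL_apply_norm, norm_smul,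
    mul_comm ‖y‖]

lemma hasGradientAt_integral_exp_inner [CompleteSpace E] {ν : Measure E} {h : E → ℝ}
    (hm : AEStronglyMeasurable h ν)
    (hi : ∀ a : ℝ, Integrable (fun y => Real.exp (a * ‖y‖) * ‖h y‖) ν) (x : E) :
    HasGradientAt (fun x => ∫ y, Real.exp (inner ℝ x y) * h y ∂ν)
      (∫ y, (Real.exp (inner ℝ x y) * h y) • y ∂ν) x := by
  rw [hasGradientAt_iff_hasFDerivAt]
  refine (hasFDerivAt_integral_exp_inner hm hi x).congr_fderiv ?_
  have hi1 := integrable_exp_inner_smul (aestronglyMeasurable_innerSL_smulRight hm)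
    (integrable_exp_mul_norm_innerSL_smulRight hm hi) x
  ext v
  rw [ContinuousLinearMap.integral_apply hi1, InnerProductSpace.toDual_apply_apply,
    real_inner_comm, ← integral_inner (integrable_exp_mul_inner_smul_self hm hi x)]
  refine integral_congr_ae (Filter.Eventually.of_forall fun y => ?_)
  simp only [_root_.smul_apply, ContinuousLinearMap.smulRight_apply,
    innerSL_apply_apply, smul_eq_mul, inner_smul_right, real_inner_comm y v]
  ring

end Laplace

/-- `F` is quantified inside the induction because each derivative takes values in `E →L[ℝ] F`; `E`
and `F` share a universe so that this space is again admissible. -/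
lemma contDiff_nat_integral_exp_inner {E : Type u} [NormedAddCommGroup E] [InnerProductSpace ℝ E]
    [MeasurableSpace E] [BorelSpace E] [SecondCountableTopology E] {ν : Measure E} (n : ℕ) :
    ∀ {F : Type u} [NormedAddCommGroup F] [NormedSpace ℝ F] {h : E → F},
      AEStronglyMeasurable h ν →
      (∀ a : ℝ, Integrable (fun y => Real.exp (a * ‖y‖) * ‖h y‖) ν) →
      ContDiff ℝ n (fun x => ∫ y, Real.exp (inner ℝ x y) • h y ∂ν) := by
  induction n with
  | zero =>
    intro F _ _ h hm hi
    exact contDiff_zero.2 (continuous_iff_continuousAt.2 fun x =>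
      (hasFDerivAt_integral_exp_inner hm hi x).continuousAt)
  | succ n ih =>
    intro F _ _ h hm hi
    rw [Nat.cast_succ, contDiff_succ_iff_hasFDerivAt]
    exact ⟨_, ih (aestronglyMeasurable_innerSL_smulRight hm)
      (integrable_exp_mul_norm_innerSL_smulRight hm hi), hasFDerivAt_integral_exp_inner hm hi⟩

lemma contDiff_integral_exp_inner {E F : Type u} [NormedAddCommGroup E] [InnerProductSpace ℝ E]
    [MeasurableSpace E] [BorelSpace E] [SecondCountableTopology E] [NormedAddCommGroup F]
    [NormedSpace ℝ F] {ν : Measure E} {h : E → F} (hm : AEStronglyMeasurable h ν)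
    (hi : ∀ a : ℝ, Integrable (fun y => Real.exp (a * ‖y‖) * ‖h y‖) ν) :
    ContDiff ℝ ((⊤ : ℕ∞) : WithTop ℕ∞) (fun x => ∫ y, Real.exp (inner ℝ x y) • h y ∂ν) :=
  contDiff_infty.2 fun n => contDiff_nat_integral_exp_inner n hm hi

/-! ### Exponential moments of `ν` and growth of the second potential. -/

section
variable {d : ℕ} {ε : ℝ} {μ ν : Measure (EuclideanSpace ℝ (Fin d))}
  {f₀ g₀ : EuclideanSpace ℝ (Fin d) → ℝ}

lemma exists_norm_le_card_mul_abs [NeZero d] (y : EuclideanSpace ℝ (Fin d)) :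
    ∃ i, ‖y‖ ≤ d * |y i| := by
  obtain ⟨i, -, hi⟩ := Finset.exists_max_image Finset.univ (fun i => |y i|) Finset.univ_nonempty
  refine ⟨i, ?_⟩
  have hd : (1 : ℝ) ≤ d := by exact_mod_cast NeZero.one_le
  refine le_of_sq_le_sq ?_ (by positivity)
  calc ‖y‖ ^ 2 = ∑ j, |y j| ^ 2 := by simp [EuclideanSpace.norm_sq_eq]
    _ ≤ ∑ _j : Fin d, |y i| ^ 2 := by
      exact Finset.sum_le_sum fun j hj => pow_le_pow_left₀ (abs_nonneg _) (hi j hj) 2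
    _ = d * |y i| ^ 2 := by simp
    _ ≤ (d * |y i|) ^ 2 := by
      rw [mul_pow]
      gcongr
      nlinarith

lemma IsSubgaussian.integrable_exp_mul_norm [IsFiniteMeasure ν] (hν : IsSubgaussian ν) (a : ℝ) :
    Integrable (fun y => Real.exp (a * ‖y‖)) ν := by
  -- In dimension `0` there are no unit vectors and the subgaussian condition is vacuous.
  rcases Nat.eq_zero_or_pos d with rfl | hd
  · have : (fun y : EuclideanSpace ℝ (Fin 0) => Real.exp (a * ‖y‖)) = fun _ => 1 := by
      funext y
      simp [Subsingleton.elim y 0]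
    rw [this]
    exact integrable_const _
  have : NeZero d := ⟨hd.ne'⟩
  obtain ⟨σ, hσ, h⟩ := hν
  have hi : ∀ i : Fin d, Integrable (fun y : EuclideanSpace ℝ (Fin d) =>
      Real.exp ((y i) ^ 2 / σ ^ 2)) ν := by
    intro i
    have h1 := h (EuclideanSpace.single i 1) (by simp)
    simp only [EuclideanSpace.inner_single_right, one_mul, conj_trivial] at h1
    exact (lintegral_ofReal_ne_top_iff_integrable
      (by fun_prop : Continuous fun y : EuclideanSpace ℝ (Fin d) =>
        Real.exp ((y i) ^ 2 / σ ^ 2)).aestronglyMeasurable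
      (Filter.Eventually.of_forall fun y => (Real.exp_pos _).le)).1
      (h1.trans_lt (by simp)).ne
  refine ((integrable_finsetSum Finset.univ fun i _ => hi i).const_mul
    (Real.exp ((|a| * d * σ / 2) ^ 2))).mono'
    (by fun_prop : Continuous fun y : EuclideanSpace ℝ (Fin d) =>
      Real.exp (a * ‖y‖)).aestronglyMeasurable (Filter.Eventually.of_forall fun y => ?_)
  obtain ⟨i, hyi⟩ := exists_norm_le_card_mul_abs y
  rw [Real.norm_eq_abs, Real.abs_exp]
  -- Young's inequality `2uv ≤ u² + v²` with `u = |a|dσ/2` and `v = |y i|/σ`, for a coordinate `i`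
  -- of largest absolute value.
  calc Real.exp (a * ‖y‖)
      ≤ Real.exp ((|a| * d * σ / 2) ^ 2 + (y i) ^ 2 / σ ^ 2) := by
        rw [Real.exp_le_exp]
        have h1 : a * ‖y‖ ≤ |a| * (d * |y i|) :=
          mul_le_mul (le_abs_self a) hyi (norm_nonneg _) (abs_nonneg _)
        have h2 : 2 * (|a| * d * σ / 2) * (|y i| / σ) = |a| * (d * |y i|) := by
          field_simp
        have h3 : (|y i| / σ) ^ 2 = (y i) ^ 2 / σ ^ 2 := by rw [div_pow, sq_abs]
        have := two_mul_le_add_sq (|a| * d * σ / 2) (|y i| / σ)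
        linarith
    _ ≤ _ := by
        rw [Real.exp_add]
        gcongr
        exact Finset.single_le_sum (f := fun i => Real.exp ((y i) ^ 2 / σ ^ 2))
          (fun i _ => (Real.exp_pos _).le) (Finset.mem_univ i)

/-- Jensen's inequality in `[0, ∞]`, which avoids assuming that `exp ∘ φ` is integrable. -/
lemma ofReal_exp_integral_le_lintegral {α : Type*} [MeasurableSpace α] {μ : Measure α}
    [IsProbabilityMeasure μ] {φ : α → ℝ} (hφ : Integrable φ μ) :
    ENNReal.ofReal (Real.exp (∫ x, φ x ∂μ)) ≤ ∫⁻ x, ENNReal.ofReal (Real.exp (φ x)) ∂μ := by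
  by_cases htop : ∫⁻ x, ENNReal.ofReal (Real.exp (φ x)) ∂μ = ⊤
  · simp [htop]
  have hi : Integrable (fun x => Real.exp (φ x)) μ :=
    (lintegral_ofReal_ne_top_iff_integrable
      (Real.continuous_exp.comp_aestronglyMeasurable hφ.1)
      (Filter.Eventually.of_forall fun y => (Real.exp_pos _).le)).1 htop
  rw [← ofReal_integral_eq_lintegral_ofReal hi
    (Filter.Eventually.of_forall fun y => (Real.exp_pos _).le)]
  exact ENNReal.ofReal_le_ofReal (convexOn_exp.map_integral_le
    Real.continuous_exp.continuousOn isClosed_univ (by simp) hφ hi)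

/-- Jensen applied to the unit-mass identity in `x` bounds `g₀ y` by `∫ ½‖y - x‖² dμ - ∫ f₀ dμ`. The
coefficient `½` of `‖y‖²` must be sharp, as it has to cancel in the Gibbs weight. -/
lemma IsEntropicPotentials.snd_le [IsProbabilityMeasure μ] [IsProbabilityMeasure ν] (hε : 0 < ε)
    (hμ : HasFiniteSecondMoment μ) (h₀ : IsEntropicPotentials ε μ ν f₀ g₀) :
    ∀ᵐ y ∂ν, g₀ y ≤ 1 / 2 * ‖y‖ ^ 2 + (1 + ∫ x, ‖x‖ ^ 2 ∂μ) * ‖y‖ +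
      (1 / 2 * (∫ x, ‖x‖ ^ 2 ∂μ) - ∫ x, f₀ x ∂μ) := by
  filter_upwards [h₀.symm.lintegral_gibbsDensity_eq_one hε] with y hy
  have hμ' : Integrable (fun x => ‖x‖ ^ 2) μ := hμ
  -- The cross term uses `‖x‖ ≤ 1 + ‖x‖²`, so that only the second moment of `μ` enters.
  have hle : ∀ x : EuclideanSpace ℝ (Fin d), 1 / 2 * ‖y - x‖ ^ 2 ≤
      1 / 2 * ‖y‖ ^ 2 + (1 + ‖x‖ ^ 2) * ‖y‖ + 1 / 2 * ‖x‖ ^ 2 := by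
    intro x
    have h1 : ‖y - x‖ ^ 2 ≤ (‖y‖ + ‖x‖) ^ 2 := by
      gcongr
      exact norm_sub_le y x
    nlinarith [mul_nonneg (norm_nonneg y) (sq_nonneg (‖x‖ - 1 / 2)), norm_nonneg y]
  have hb1 : Integrable (fun x : EuclideanSpace ℝ (Fin d) => 1 + ‖x‖ ^ 2) μ :=
    (integrable_const _).add hμ'
  have hb2 : Integrable (fun x : EuclideanSpace ℝ (Fin d) =>
      1 / 2 * ‖y‖ ^ 2 + (1 + ‖x‖ ^ 2) * ‖y‖) μ := (integrable_const _).add (hb1.mul_const _)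
  have hbd : Integrable (fun x : EuclideanSpace ℝ (Fin d) =>
      1 / 2 * ‖y‖ ^ 2 + (1 + ‖x‖ ^ 2) * ‖y‖ + 1 / 2 * ‖x‖ ^ 2) μ := hb2.add (hμ'.const_mul _)
  have hc : Integrable (fun x => 1 / 2 * ‖y - x‖ ^ 2) μ :=
    hbd.mono' (by fun_prop : Continuous fun x : EuclideanSpace ℝ (Fin d) =>
      1 / 2 * ‖y - x‖ ^ 2).aestronglyMeasurable (Filter.Eventually.of_forall fun x => by
        rw [Real.norm_of_nonneg (by positivity)]
        exact hle x)
  have hc1 : Integrable (fun x => 1 / 2 * ‖y - x‖ ^ 2 - g₀ y) μ := hc.sub (integrable_const _)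
  have hφ : Integrable (fun x => -(1 / ε) * (1 / 2 * ‖y - x‖ ^ 2 - g₀ y - f₀ x)) μ :=
    (hc1.sub h₀.1).const_mul _
  have hJ := ofReal_exp_integral_le_lintegral hφ
  have hy' : ∫⁻ x, ENNReal.ofReal (Real.exp (-(1 / ε) * (1 / 2 * ‖y - x‖ ^ 2 - g₀ y - f₀ x))) ∂μ
    = 1 := hy
  rw [hy', ENNReal.ofReal_le_one, Real.exp_le_one_iff, integral_const_mul,
    integral_sub hc1 h₀.1, integral_sub hc (integrable_const _)] at hJ
  have hcle := integral_mono hc hbd hle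
  rw [integral_add hb2 (hμ'.const_mul _),
    integral_add (integrable_const _) (hb1.mul_const _), integral_mul_const ‖y‖,
    integral_add (integrable_const _) hμ'] at hcle
  simp only [integral_const_mul, integral_const, probReal_univ, one_smul] at hJ hcle
  have h1 : 0 ≤ 1 / 2 * (∫ x, ‖y - x‖ ^ 2 ∂μ) - g₀ y - ∫ x, f₀ x ∂μ := by
    have : 0 < 1 / ε := by positivity
    by_contra hneg
    nlinarith
  linarith

lemma IsEntropicPotentials.integrable_exp_mul_norm_weight [IsProbabilityMeasure μ]
    [IsProbabilityMeasure ν] (hε : 0 < ε) (hμ : HasFiniteSecondMoment μ) (hν : IsSubgaussian ν)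
    (h₀ : IsEntropicPotentials ε μ ν f₀ g₀) (a : ℝ) :
    Integrable (fun y => Real.exp (a * ‖y‖) *
      ‖Real.exp (1 / ε * (g₀ y - 1 / 2 * ‖y‖ ^ 2))‖) ν := by
  set M := 1 + ∫ x, ‖x‖ ^ 2 ∂μ with hM
  set C := 1 / 2 * (∫ x, ‖x‖ ^ 2 ∂μ) - ∫ x, f₀ x ∂μ with hC
  have hg := h₀.2.1.aemeasurable
  refine ((hν.integrable_exp_mul_norm (a + 1 / ε * M)).const_mul (Real.exp (1 / ε * C))).mono'
    ?_ ?_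
  · exact AEMeasurable.aestronglyMeasurable (by fun_prop)
  · filter_upwards [h₀.snd_le hε hμ] with y hy
    rw [Real.norm_of_nonneg (by positivity), Real.norm_of_nonneg (by positivity), ← Real.exp_add,
      ← Real.exp_add, Real.exp_le_exp]
    have : 1 / ε * (g₀ y - 1 / 2 * ‖y‖ ^ 2) ≤ 1 / ε * (M * ‖y‖ + C) := by
      gcongr
      linarith
    linarith

end

/-! ### The extended potentials, their Laplace representation and their gradient. -/

variable {d : ℕ} {ε : ℝ} {μ ν : Measure (EuclideanSpace ℝ (Fin d))}
  {f₀ g₀ : EuclideanSpace ℝ (Fin d) → ℝ} {f g : EuclideanSpace ℝ (Fin d) → EReal}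

lemma softTransform_congr {g' : EuclideanSpace ℝ (Fin d) → EReal} (h : ∀ᵐ y ∂ν, g y = g' y) :
    softTransform ε ν g = softTransform ε ν g' := by
  funext x
  have : ∫⁻ y, gibbsWeight ε g x y ∂ν = ∫⁻ y, gibbsWeight ε g' x y ∂ν := by
    refine lintegral_congr_ae ?_
    filter_upwards [h] with y hy
    rw [gibbsWeight, gibbsWeight, hy]
  rw [softTransform, softTransform, this]

lemma gibbsWeight_of_eq_coe {x y : EuclideanSpace ℝ (Fin d)} (h : g y = (g₀ y : EReal)) :
    gibbsWeight ε g x y =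
      ENNReal.ofReal (Real.exp (1 / ε * (-(1 / 2 * ‖x - y‖ ^ 2) + g₀ y))) := by
  rw [gibbsWeight, h, ← EReal.coe_add, ← EReal.coe_mul, EReal.exp_coe]

/-- Expanding `‖x - y‖²` isolates a factor depending on `x` alone; it cancels in `entropicMap` and
yields the `½‖x‖²` term of the potential. -/
lemma toReal_gibbsWeight_of_eq_coe {x y : EuclideanSpace ℝ (Fin d)} (h : g y = (g₀ y : EReal)) :
    (gibbsWeight ε g x y).toReal = Real.exp (-(1 / (2 * ε)) * ‖x‖ ^ 2) *
      (Real.exp (inner ℝ ((1 / ε) • x) y) * Real.exp (1 / ε * (g₀ y - 1 / 2 * ‖y‖ ^ 2))) := by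
  rw [gibbsWeight_of_eq_coe h, ENNReal.toReal_ofReal (Real.exp_nonneg _), ← Real.exp_add,
    ← Real.exp_add, norm_sub_sq_real, real_inner_smul_left]
  congr 1
  ring

lemma IsEntropicPotentials.ae_eq_softTransform [IsProbabilityMeasure μ] [IsProbabilityMeasure ν]
    (hε : 0 < ε) (h₀ : IsEntropicPotentials ε μ ν f₀ g₀) :
    ∀ᵐ x ∂μ, softTransform ε ν (fun y => (g₀ y : EReal)) x = f₀ x := by
  filter_upwards [h₀.lintegral_gibbsDensity_eq_one hε] with x hx
  have hmul : ∫⁻ y, gibbsWeight ε (fun y => (g₀ y : EReal)) x y ∂ν =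
      ENNReal.ofReal (Real.exp (-(1 / ε) * f₀ x)) := by
    rw [← mul_one (ENNReal.ofReal _), ← hx, ← lintegral_const_mul' _ _ ENNReal.ofReal_ne_top]
    refine lintegral_congr fun y => ?_
    rw [gibbsWeight_of_eq_coe (g₀ := g₀) rfl, gibbsDensity, ← ENNReal.ofReal_mul (Real.exp_nonneg _),
      ← Real.exp_add]
    congr 2
    ring
  rw [softTransform, hmul, ENNReal.log_ofReal_of_pos (Real.exp_pos _), Real.log_exp,
    ← EReal.coe_mul, ← EReal.coe_neg]
  congr 1
  field_simp

/-- This is uniqueness: the right-hand sides depend only on `f₀` and `g₀`. -/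
lemma IsExtension.eq_softTransform (h : IsExtension ε μ ν f₀ g₀ f g) :
    f = softTransform ε ν (fun y => (g₀ y : EReal)) ∧
      g = softTransform ε μ (fun x => (f₀ x : EReal)) :=
  ⟨(funext h.f_eq).trans (softTransform_congr h.g_ae),
    (funext h.g_eq).trans (softTransform_congr h.f_ae)⟩

lemma IsEntropicPotentials.isExtension_softTransform [IsProbabilityMeasure μ]
    [IsProbabilityMeasure ν] (hε : 0 < ε) (h₀ : IsEntropicPotentials ε μ ν f₀ g₀) :
    IsExtension ε μ ν f₀ g₀ (softTransform ε ν (fun y => (g₀ y : EReal)))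
      (softTransform ε μ (fun x => (f₀ x : EReal))) where
  f_ae := h₀.ae_eq_softTransform hε
  g_ae := h₀.symm.ae_eq_softTransform hε
  f_eq := fun _ => (congrFun (softTransform_congr (h₀.symm.ae_eq_softTransform hε)) _).symm
  g_eq := fun _ => (congrFun (softTransform_congr (h₀.ae_eq_softTransform hε)) _).symm

/-- The Laplace transform of the measure with density `exp ((g₀ y - ½‖y‖²) / ε)` with respect
to `ν`. -/
noncomputable def potentialLaplace {d : ℕ} (ε : ℝ) (ν : Measure (EuclideanSpace ℝ (Fin d)))
    (g₀ : EuclideanSpace ℝ (Fin d) → ℝ) (x : EuclideanSpace ℝ (Fin d)) : ℝ :=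
  ∫ y, Real.exp (inner ℝ x y) * Real.exp (1 / ε * (g₀ y - 1 / 2 * ‖y‖ ^ 2)) ∂ν

lemma potentialLaplace_pos [NeZero ν]
    (hm : AEStronglyMeasurable (fun y => Real.exp (1 / ε * (g₀ y - 1 / 2 * ‖y‖ ^ 2))) ν)
    (hi : ∀ a : ℝ, Integrable (fun y => Real.exp (a * ‖y‖) *
      ‖Real.exp (1 / ε * (g₀ y - 1 / 2 * ‖y‖ ^ 2))‖) ν)
    (x : EuclideanSpace ℝ (Fin d)) : 0 < potentialLaplace ε ν g₀ x := by
  simp_rw [potentialLaplace, ← Real.exp_add]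
  refine integral_exp_pos ?_
  simp_rw [Real.exp_add]
  exact integrable_exp_inner_smul hm hi x

lemma integrable_toReal_gibbsWeight
    (hm : AEStronglyMeasurable (fun y => Real.exp (1 / ε * (g₀ y - 1 / 2 * ‖y‖ ^ 2))) ν)
    (hi : ∀ a : ℝ, Integrable (fun y => Real.exp (a * ‖y‖) *
      ‖Real.exp (1 / ε * (g₀ y - 1 / 2 * ‖y‖ ^ 2))‖) ν)
    (hg : ∀ᵐ y ∂ν, g y = (g₀ y : EReal))
    (x : EuclideanSpace ℝ (Fin d)) :
    Integrable (fun y => (gibbsWeight ε g x y).toReal) ν := by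
  refine ((integrable_exp_inner_smul hm hi ((1 / ε) • x)).const_mul
    (Real.exp (-(1 / (2 * ε)) * ‖x‖ ^ 2))).congr ?_
  filter_upwards [hg] with y hy
  rw [toReal_gibbsWeight_of_eq_coe hy, smul_eq_mul]

lemma integrable_toReal_gibbsWeight_smul
    (hm : AEStronglyMeasurable (fun y => Real.exp (1 / ε * (g₀ y - 1 / 2 * ‖y‖ ^ 2))) ν)
    (hi : ∀ a : ℝ, Integrable (fun y => Real.exp (a * ‖y‖) *
      ‖Real.exp (1 / ε * (g₀ y - 1 / 2 * ‖y‖ ^ 2))‖) ν)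
    (hg : ∀ᵐ y ∂ν, g y = (g₀ y : EReal))
    (x : EuclideanSpace ℝ (Fin d)) :
    Integrable (fun y => (gibbsWeight ε g x y).toReal • y) ν := by
  refine ((integrable_exp_mul_inner_smul_self hm hi ((1 / ε) • x)).smul
    (Real.exp (-(1 / (2 * ε)) * ‖x‖ ^ 2))).congr ?_
  filter_upwards [hg] with y hy
  rw [toReal_gibbsWeight_of_eq_coe hy, Pi.smul_apply, smul_smul]

lemma integral_toReal_gibbsWeight (hg : ∀ᵐ y ∂ν, g y = (g₀ y : EReal))
    (x : EuclideanSpace ℝ (Fin d)) :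
    ∫ y, (gibbsWeight ε g x y).toReal ∂ν =
      Real.exp (-(1 / (2 * ε)) * ‖x‖ ^ 2) * potentialLaplace ε ν g₀ ((1 / ε) • x) := by
  rw [potentialLaplace, ← integral_const_mul]
  refine integral_congr_ae ?_
  filter_upwards [hg] with y hy
  rw [toReal_gibbsWeight_of_eq_coe hy]

lemma softTransform_eq_coe (hε : 0 < ε) [NeZero ν]
    (hm : AEStronglyMeasurable (fun y => Real.exp (1 / ε * (g₀ y - 1 / 2 * ‖y‖ ^ 2))) ν)
    (hi : ∀ a : ℝ, Integrable (fun y => Real.exp (a * ‖y‖) *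
      ‖Real.exp (1 / ε * (g₀ y - 1 / 2 * ‖y‖ ^ 2))‖) ν)
    (hg : ∀ᵐ y ∂ν, g y = (g₀ y : EReal)) (x : EuclideanSpace ℝ (Fin d)) :
    softTransform ε ν g x =
      ((1 / 2 * ‖x‖ ^ 2 - ε * Real.log (potentialLaplace ε ν g₀ ((1 / ε) • x)) : ℝ) : EReal) := by
  have hL := potentialLaplace_pos hm hi ((1 / ε) • x)
  -- `g` may be infinite on a `ν`-null set, so the weight is finite only almost everywhere.
  have hW : ∫⁻ y, gibbsWeight ε g x y ∂ν =
      ENNReal.ofReal (∫ y, (gibbsWeight ε g x y).toReal ∂ν) := by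
    rw [ofReal_integral_eq_lintegral_ofReal (integrable_toReal_gibbsWeight hm hi hg x)
      (Filter.Eventually.of_forall fun y => ENNReal.toReal_nonneg)]
    refine lintegral_congr_ae ?_
    filter_upwards [hg] with y hy
    rw [ENNReal.ofReal_toReal]
    rw [gibbsWeight_of_eq_coe hy]
    exact ENNReal.ofReal_ne_top
  rw [softTransform, hW, integral_toReal_gibbsWeight hg,
    ENNReal.log_ofReal_of_pos (by positivity), Real.log_mul (Real.exp_ne_zero _) hL.ne',
    Real.log_exp, ← EReal.coe_mul, ← EReal.coe_neg]
  congr 1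
  field_simp
  ring

lemma entropicMap_eq
    (hg : ∀ᵐ y ∂ν, g y = (g₀ y : EReal)) (x : EuclideanSpace ℝ (Fin d)) :
    entropicMap ε ν g x = (potentialLaplace ε ν g₀ ((1 / ε) • x))⁻¹ •
      ∫ y, (Real.exp (inner ℝ ((1 / ε) • x) y) *
        Real.exp (1 / ε * (g₀ y - 1 / 2 * ‖y‖ ^ 2))) • y ∂ν := by
  have h1 : ∫ y, (gibbsWeight ε g x y).toReal • y ∂ν = Real.exp (-(1 / (2 * ε)) * ‖x‖ ^ 2) •
      ∫ y, (Real.exp (inner ℝ ((1 / ε) • x) y) *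
        Real.exp (1 / ε * (g₀ y - 1 / 2 * ‖y‖ ^ 2))) • y ∂ν := by
    rw [← integral_smul]
    refine integral_congr_ae ?_
    filter_upwards [hg] with y hy
    rw [toReal_gibbsWeight_of_eq_coe hy, smul_smul]
  rw [entropicMap, integral_toReal_gibbsWeight hg, h1, smul_smul, mul_inv_rev,
    inv_mul_cancel_right₀ (Real.exp_ne_zero _)]

lemma hasGradientAt_sq_norm_sub_log_potentialLaplace (hε : 0 < ε) [NeZero ν]
    (hm : AEStronglyMeasurable (fun y => Real.exp (1 / ε * (g₀ y - 1 / 2 * ‖y‖ ^ 2))) ν)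
    (hi : ∀ a : ℝ, Integrable (fun y => Real.exp (a * ‖y‖) *
      ‖Real.exp (1 / ε * (g₀ y - 1 / 2 * ‖y‖ ^ 2))‖) ν)
    (x : EuclideanSpace ℝ (Fin d)) :
    HasGradientAt
      (fun z => 1 / 2 * ‖z‖ ^ 2 - ε * Real.log (potentialLaplace ε ν g₀ ((1 / ε) • z)))
      (x - (potentialLaplace ε ν g₀ ((1 / ε) • x))⁻¹ •
        ∫ y, (Real.exp (inner ℝ ((1 / ε) • x) y) *
          Real.exp (1 / ε * (g₀ y - 1 / 2 * ‖y‖ ^ 2))) • y ∂ν) x := by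
  have hL := potentialLaplace_pos hm hi ((1 / ε) • x)
  have h1 : HasFDerivAt (potentialLaplace ε ν g₀) _ ((1 / ε) • x) :=
    (hasGradientAt_integral_exp_inner hm hi ((1 / ε) • x)).hasFDerivAt
  have h2 : HasFDerivAt (fun z : EuclideanSpace ℝ (Fin d) => (1 / ε) • z)
      ((1 / ε) • ContinuousLinearMap.id ℝ (EuclideanSpace ℝ (Fin d))) x :=
    ((1 / ε) • ContinuousLinearMap.id ℝ (EuclideanSpace ℝ (Fin d))).hasFDerivAt
  have h3 := ((h1.comp x h2).log hL.ne').const_mul ε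
  have h4 := (hasStrictFDerivAt_norm_sq x).hasFDerivAt.const_mul (1 / 2)
  rw [hasGradientAt_iff_hasFDerivAt]
  refine (h4.sub h3).congr_fderiv ?_
  ext v
  simp only [_root_.sub_apply, _root_.smul_apply, ContinuousLinearMap.comp_apply,
    InnerProductSpace.toDual_apply_apply, inner_sub_left, real_inner_smul_left, smul_eq_mul,
    innerSL_apply_apply, ContinuousLinearMap.id_apply, inner_smul_right, Function.comp_apply,
    nsmul_eq_mul]
  field_simp
  push_cast
  ring

lemma contDiff_sq_norm_sub_log_potentialLaplace [NeZero ν]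
    (hm : AEStronglyMeasurable (fun y => Real.exp (1 / ε * (g₀ y - 1 / 2 * ‖y‖ ^ 2))) ν)
    (hi : ∀ a : ℝ, Integrable (fun y => Real.exp (a * ‖y‖) *
      ‖Real.exp (1 / ε * (g₀ y - 1 / 2 * ‖y‖ ^ 2))‖) ν) :
    ContDiff ℝ ((⊤ : ℕ∞) : WithTop ℕ∞)
      (fun z => 1 / 2 * ‖z‖ ^ 2 - ε * Real.log (potentialLaplace ε ν g₀ ((1 / ε) • z))) := by
  have h1 : ContDiff ℝ ((⊤ : ℕ∞) : WithTop ℕ∞) (potentialLaplace ε ν g₀) :=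
    contDiff_integral_exp_inner hm hi
  have h2 := (h1.comp (contDiff_id.const_smul (1 / ε))).log
    fun z => (potentialLaplace_pos hm hi ((1 / ε) • z)).ne'
  exact (contDiff_const.mul (contDiff_norm_sq ℝ (n := (⊤ : ℕ∞)))).sub (contDiff_const.mul h2)

end EntropicOT

theorem proposition2p3 {d : ℕ} (ε : ℝ) (hε : 0 < ε)
    (μ ν : Measure (EuclideanSpace ℝ (Fin d)))
    [IsProbabilityMeasure μ] [IsProbabilityMeasure ν]
    (hμ : EntropicOT.HasFiniteSecondMoment μ) (hν : EntropicOT.IsSubgaussian ν)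
    (f₀ g₀ : EuclideanSpace ℝ (Fin d) → ℝ)
    (h₀ : EntropicOT.IsEntropicPotentials ε μ ν f₀ g₀) :
    (∃! p : (EuclideanSpace ℝ (Fin d) → EReal) × (EuclideanSpace ℝ (Fin d) → EReal),
      EntropicOT.IsExtension ε μ ν f₀ g₀ p.1 p.2) ∧
    ∀ f g : EuclideanSpace ℝ (Fin d) → EReal, EntropicOT.IsExtension ε μ ν f₀ g₀ f g →
      (∀ x, f x ≠ ⊥ ∧ f x ≠ ⊤) ∧
      ContDiff ℝ ((⊤ : ℕ∞) : WithTop ℕ∞) (fun x => (f x).toReal) ∧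
      ∀ x, Integrable (fun y => (EntropicOT.gibbsWeight ε g x y).toReal) ν ∧
        Integrable (fun y => (EntropicOT.gibbsWeight ε g x y).toReal • y) ν ∧
        0 < ∫ y, (EntropicOT.gibbsWeight ε g x y).toReal ∂ν ∧
        HasGradientAt (fun z => (f z).toReal) (x - EntropicOT.entropicMap ε ν g x) x := by
  refine ⟨⟨(_, _), h₀.isExtension_softTransform hε, fun p hp => Prod.ext hp.eq_softTransform.1
    hp.eq_softTransform.2⟩, fun f g hfg => ?_⟩
  have hg₀ := h₀.2.1.aemeasurable
  have hm : AEStronglyMeasurable (fun y => Real.exp (1 / ε * (g₀ y - 1 / 2 * ‖y‖ ^ 2))) ν :=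
    AEMeasurable.aestronglyMeasurable (by fun_prop)
  have hi := h₀.integrable_exp_mul_norm_weight hε hμ hν
  have hf : ∀ x, f x = _ := fun x =>
    (hfg.f_eq x).trans (EntropicOT.softTransform_eq_coe hε hm hi hfg.g_ae x)
  have hf' : (fun x => (f x).toReal) = fun x => 1 / 2 * ‖x‖ ^ 2 -
      ε * Real.log (EntropicOT.potentialLaplace ε ν g₀ ((1 / ε) • x)) := by
    funext x
    rw [hf x, EReal.toReal_coe]
  refine ⟨fun x => ?_, ?_, fun x => ⟨EntropicOT.integrable_toReal_gibbsWeight hm hi hfg.g_ae x,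
    EntropicOT.integrable_toReal_gibbsWeight_smul hm hi hfg.g_ae x, ?_, ?_⟩⟩
  · rw [hf x]
    exact ⟨EReal.coe_ne_bot _, EReal.coe_ne_top _⟩
  · rw [hf']
    exact EntropicOT.contDiff_sq_norm_sub_log_potentialLaplace hm hi
  · rw [EntropicOT.integral_toReal_gibbsWeight hfg.g_ae]
    exact mul_pos (Real.exp_pos _) (EntropicOT.potentialLaplace_pos hm hi _)
  · rw [hf', EntropicOT.entropicMap_eq hfg.g_ae]
    exact EntropicOT.hasGradientAt_sq_norm_sub_log_potentialLaplace hε hm hi x
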